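/- **Lemma 2.4 (Degree of a tropical curve).** Let $e_1,\dots,e_n$ be the standard basis of $\mathbb Z^n$ and $e_0:=-e_1-\cdots-e_n$. A *tropical fan curve* in $\mathbb R^n$ consists of finitely many distinct rays $\mathbb R_{\ge 0}r_1,\dots,\mathbb R_{\ge 0}r_k$ in primitive integral directions $r_i\in\mathbb Z^n$, with positive integer multiplicities $m_1,\dots,m_k$, such that $\sum_i m_i r_i=0$. The *tropical hyperplane* (max convention) is the fan whose maximal cones are the cones spanned by any $n-1$ of the $n+1$ vectors $-e_0=(1,\dots,1),-e_1,\dots,-e_n$, each with multiplicity $1$. The *degree* of a tropical fan curve is its stable intersection number with the tropical hyperplane, i.e. the multiplicity of the origin in their stable intersection: the number $$\sum_{(i,\tau)} m_i\,\bigl[\mathbb Z^n:(\mathbb Z^n\cap\mathbb R r_i)+(\mathbb Z^n\cap\operatorname{span}\tau)\bigr],$$ where the sum runs over all rays $i$ and all maximal cones $\tau$ of the tropical hyperplane with $\mathbb R_{\ge 0}r_i\cap(\tau+v)\neq\emptyset$, for a generic $v\in\mathbb R^n$. Here $v$ is generic if it lies in no proper linear subspace of $\mathbb R^n$ of the form $\operatorname{span}\rho+\operatorname{span}\tau'$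 with $\rho\in\{\{0\},\mathbb R_{\ge0}r_1,\dots,\mathbb R_{\ge0}r_k\}$ and $\tau'$ a face of a maximal cone of the tropical hyperplane. For every tropical fan curve as above: 1. Each $r_i$ can be written as $r_i=\sum_{j=0}^n a_{ij}(-e_j)$ with nonnegative integers $a_{i0},\dots,a_{in}$, at least one of which is zero. 2. The degree $d$ of the curve is well defined: generic $v$ exist, and the sum above has the same value $d$ for all of them. 3. For all decompositions of $r_1,\dots,r_k$ as in 1, one has $\sum_{i=1}^k m_i a_{ij}=d$ for every $j=0,\dots,n$. 4. Equivalently, if $m_i r_i=\sum_{j=0}^n b_{ij}(-e_j)$ with nonnegative integers $b_{ij}$, for each $i$ at least one $b_{ij}$ being zero, then $\sum_{i=1}^k b_{ij}=d$ for every $j=0,\dots,n$. -/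

import Mathlib

namespace TropicalFan

/-- An integer vector viewed as a point of `ℝⁿ`, as an additive homomorphism. -/
def toReal (n : ℕ) : (Fin n → ℤ) →+ (Fin n → ℝ) where
  toFun u i := (u i : ℝ)
  map_zero' := by ext i; simp
  map_add' u w := by ext i; simp

/-- The closed convex cone spanned by a finite set of integer vectors
(`{0}` if the set is empty). -/
def cone {n : ℕ} (S : Finset (Fin n → ℤ)) : Set (Fin n → ℝ) :=
  {x | ∃ c : (Fin n → ℤ) → ℝ, (∀ u ∈ S, 0 ≤ c u) ∧ x = ∑ u ∈ S, c u • toReal n u}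

/-- The real linear span of a finite set of integer vectors. -/
def linSpan {n : ℕ} (S : Finset (Fin n → ℤ)) : Submodule ℝ (Fin n → ℝ) :=
  Submodule.span ℝ (toReal n '' (S : Set (Fin n → ℤ)))

/-- The lattice `ℤⁿ ∩ span S` of all integer points of the linear span of the cone on `S`. -/
def lattice {n : ℕ} (S : Finset (Fin n → ℤ)) : AddSubgroup (Fin n → ℤ) :=
  (linSpan S).toAddSubgroup.comap (toReal n)

/-- The lattice index `[ℤⁿ : (ℤⁿ ∩ span S) + (ℤⁿ ∩ span T)]`; it is finite exactly if
the two spans together span `ℝⁿ`, and it has the value `0` otherwise. -/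
noncomputable def latticeIndex {n : ℕ} (S T : Finset (Fin n → ℤ)) : ℕ :=
  (lattice S ⊔ lattice T).index

/-- A displacement vector `v` is generic for two finite families of rational cones if it avoids
every proper linear subspace that is spanned by a face of a cone of the first family together
with a face of a cone of the second family. These are finitely many proper subspaces. -/
def IsGeneric {n : ℕ} {ι κ : Type} (σ : ι → Finset (Fin n → ℤ)) (τ : κ → Finset (Fin n → ℤ))
    (v : Fin n → ℝ) : Prop :=
  ∀ i k, ∀ S ⊆ σ i, ∀ T ⊆ τ k, linSpan S ⊔ linSpan T ≠ ⊤ → v ∉ linSpan S ⊔ linSpan T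

open Classical in
/-- For two weighted fans, with maximal cones `cone (σ i)` of multiplicity `m i` and
`cone (τ k)` of multiplicity `w k`: the number of intersection points of the first fan with the
translate of the second one by `v`, where a pair of cones that meet
after the translation counts with the product of the multiplicities and the lattice index. -/
noncomputable def displacedNumber {n : ℕ} {ι κ : Type} [Fintype ι] [Fintype κ]
    (σ : ι → Finset (Fin n → ℤ)) (m : ι → ℕ) (τ : κ → Finset (Fin n → ℤ)) (w : κ → ℕ)
    (v : Fin n → ℝ) : ℕ :=
  ∑ i, ∑ k, if (∃ x ∈ cone (σ i), ∃ y ∈ cone (τ k), x = y + v)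
    then m i * w k * latticeIndex (σ i) (τ k) else 0

/-- `N` is the stable intersection number of two weighted fans of complementary dimension, that is,
the multiplicity of the origin in their stable intersection (fan displacement rule; the star
of a fan at the origin is the fan itself): generic displacements exist, and each one of them
gives `N` intersection points. At most one `N` has this property. -/
def IsStableIntersectionNumber {n : ℕ} {ι κ : Type} [Fintype ι] [Fintype κ]
    (σ : ι → Finset (Fin n → ℤ)) (m : ι → ℕ) (τ : κ → Finset (Fin n → ℤ)) (w : κ → ℕ)
    (N : ℕ) : Prop :=
  (∃ v, IsGeneric σ τ v) ∧ ∀ v, IsGeneric σ τ v → displacedNumber σ m τ w v = N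

/-- `e 0 = -e₁ - ⋯ - eₙ`, and `e 1, …, e n` are the standard basis vectors of `ℤⁿ`. -/
def e {n : ℕ} : Fin (n + 1) → Fin n → ℤ :=
  Fin.cases (-∑ i : Fin n, Pi.single i 1) (fun i => Pi.single i 1)

/-- The index set of the maximal cones of the tropical hyperplane in `ℝⁿ`:
the sets of `n - 1` of the `n + 1` rays. -/
abbrev HyperplaneIndex (n : ℕ) : Type := {J : Finset (Fin (n + 1)) // J.card + 1 = n}

/-- The generators of the maximal cones of the (max-convention) tropical hyperplane: the cones
spanned by any `n - 1` of the rays `-e₀ = (1, …, 1), -e₁, …, -eₙ`. -/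
def hyperplaneCone (n : ℕ) (J : HyperplaneIndex n) : Finset (Fin n → ℤ) :=
  J.1.image (fun j => -e j)

/-- A tropical fan curve in `ℝⁿ`: finitely many distinct rays from the origin in primitive
integral directions, with positive integer multiplicities, subject to the balancing condition. -/
structure Curve (n : ℕ) where
  /-- the number of rays -/
  k : ℕ
  /-- the ray directions -/
  r : Fin k → Fin n → ℤ
  /-- the multiplicities -/
  m : Fin k → ℕ
  primitive : ∀ i, Finset.univ.gcd (r i) = 1
  distinct : Function.Injective r
  mult_pos : ∀ i, 0 < m i
  balanced : ∑ i, m i • r i = 0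

/-- `C` has degree `d`: the stable intersection number of `C` with the tropical hyperplane, all of
whose maximal cones have multiplicity one, is `d`. -/
def Curve.HasDegree {n : ℕ} (C : Curve n) (d : ℕ) : Prop :=
  IsStableIntersectionNumber (fun i => {C.r i}) C.m (hyperplaneCone n) (fun _ => 1) d

/-- `u = a₀ (-e₀) + ⋯ + aₙ (-eₙ)` with nonnegative integer coefficients that are not all
nonzero. -/
def IsDecomposition {n : ℕ} (u : Fin n → ℤ) (a : Fin (n + 1) → ℕ) : Prop :=
  u = ∑ j, a j • (-e j) ∧ ∃ j, a j = 0

end TropicalFan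

/-! Work in homogeneous coordinates: `ofHom` identifies vectors modulo multiples of (1,…,1) with
points of the space. Let w be coordinates of v and a those of a ray r. The point t·r lies in the
displaced hyperplane iff the minimum of the lines t·a_j - w_j is attained twice (`ray_meets_iff`),
and a pair {p, q} counts with index |a_p - a_q| (`latticeIndex_ray`), the drop in slope of the lower
envelope there. For generic v the envelope starts at t = 0 with slope a_{j₀}, where w is maximal at
j₀, and ends with slope min a = 0, so the ray contributes a_{j₀} (`sum_latticeIndex_ray`). Balancing
makes the weighted sum of the a_{ij} independent of j, hence of v. -/

namespace TropicalFan

/-! ### Homogeneous coordinates, cones and spans -/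

variable {n : ℕ}

/-- The point `∑ j, c j • (-e j)` with homogeneous coordinates `c`. -/
def ofHom {R : Type*} [Ring R] (c : Fin (n + 1) → R) : Fin n → R :=
  fun i => c 0 - c i.succ

/-- The homogeneous coordinates of a point, normalised by the vanishing of the zeroth one. -/
def toHom {R : Type*} [Ring R] (y : Fin n → R) : Fin (n + 1) → R :=
  Fin.cons 0 (-y)

theorem ofHom_toHom {R : Type*} [Ring R] (y : Fin n → R) : ofHom (toHom y) = y := by
  ext i; simp [ofHom, toHom]

theorem ofHom_eq_iff {R : Type*} [Ring R] {c c' : Fin (n + 1) → R} :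
    ofHom c = ofHom c' ↔ ∀ j k, c j - c k = c' j - c' k := by
  constructor
  · intro h
    have h0 : ∀ j, c 0 - c j = c' 0 - c' j := by
      intro j
      refine Fin.cases (by simp) (fun i => ?_) j
      exact congrFun h i
    intro j k
    rw [← sub_sub_sub_cancel_left (c k) (c j) (c 0), h0, h0, sub_sub_sub_cancel_left]
  · intro h
    ext i
    exact h 0 i.succ

theorem sum_smul_neg_e (a : Fin (n + 1) → ℕ) :
    ∑ j, a j • (-e j : Fin n → ℤ) = ofHom (fun j => (a j : ℤ)) := by
  ext i
  simp [Fin.sum_univ_succ, e, ofHom, Finset.sum_apply, Pi.single_apply, sub_eq_add_neg,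
    add_comm]

theorem sum_smul_toReal_neg_e (c : Fin (n + 1) → ℝ) :
    ∑ j, c j • toReal n (-e j) = ofHom c := by
  ext i
  simp [Fin.sum_univ_succ, e, ofHom, Finset.sum_apply, Pi.single_apply, sub_eq_add_neg, toReal,
    add_comm]

theorem neg_e_eq_ofHom (j : Fin (n + 1)) : -e j = ofHom (Pi.single j (1 : ℤ)) := by
  have h := sum_smul_neg_e (n := n) (Pi.single j 1)
  rw [Finset.sum_eq_single j] at h
  · rw [Pi.single_eq_same, one_smul] at h
    rw [h]
    congr 1
    ext k
    by_cases hk : k = j <;> simp [hk]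
  · intro b _ hb; simp [hb]
  · simp

theorem neg_e_injective : Function.Injective (fun j : Fin (n + 1) => -(e j : Fin n → ℤ)) := by
  intro j k h
  by_contra hjk
  simp only [neg_e_eq_ofHom] at h
  have := ofHom_eq_iff.1 h j k
  simp [hjk, Ne.symm hjk] at this

theorem toReal_ofHom (c : Fin (n + 1) → ℤ) :
    toReal n (ofHom c) = ofHom (fun j => (c j : ℝ)) := by
  ext i; simp [toReal, ofHom]

theorem mem_cone_image_iff (J : Finset (Fin (n + 1))) (x : Fin n → ℝ) :
    x ∈ cone (J.image (fun j => -e j)) ↔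
      ∃ c : Fin (n + 1) → ℝ, (∀ j, 0 ≤ c j) ∧ (∀ j ∉ J, c j = 0) ∧ x = ofHom c := by
  classical
  constructor
  · rintro ⟨c, hc, rfl⟩
    refine ⟨fun j => if j ∈ J then c (-e j) else 0, fun j => ?_, fun j hj => by simp [hj], ?_⟩
    · by_cases hj : j ∈ J
      · simpa [hj] using hc _ (Finset.mem_image_of_mem (fun j => -e j) hj)
      · simp [hj]
    · rw [← sum_smul_toReal_neg_e, Finset.sum_image (fun _ _ _ _ h => neg_e_injective h)]
      simp [ite_smul]
  · rintro ⟨c, hc, hJ, rfl⟩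
    refine ⟨Function.extend (fun j => -e j) c 0, ?_, ?_⟩
    · intro u hu
      obtain ⟨j, -, rfl⟩ := Finset.mem_image.1 hu
      rw [neg_e_injective.extend_apply]
      exact hc j
    · rw [← sum_smul_toReal_neg_e, Finset.sum_image (fun _ _ _ _ h => neg_e_injective h)]
      simp only [neg_e_injective.extend_apply]
      symm
      apply Finset.sum_subset (Finset.subset_univ _)
      intro j _ hj
      simp [hJ j hj]

theorem ofHom_mem_linSpan {J : Finset (Fin (n + 1))} {c : Fin (n + 1) → ℝ}
    (hc : ∀ j ∉ J, c j = 0) : ofHom c ∈ linSpan (J.image (fun j => -e j)) := by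
  rw [← sum_smul_toReal_neg_e]
  refine Submodule.sum_mem _ fun j _ => ?_
  by_cases hj : j ∈ J
  · refine Submodule.smul_mem _ _ (Submodule.subset_span ⟨_, ?_, rfl⟩)
    exact Finset.mem_image_of_mem (fun j => -e j) hj
  · simp [hc j hj]

/-! ### Lattices and their indices -/

/-- The lattice homomorphism `y ↦ y_p - y_q` in homogeneous coordinates. -/
def coordDiff (p q : Fin (n + 1)) : (Fin n → ℤ) →+ ℤ where
  toFun y := toHom y p - toHom y q
  map_zero' := by
    have : ∀ p : Fin (n + 1), toHom (0 : Fin n → ℤ) p = 0 := fun p => by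
      refine Fin.cases ?_ (fun i => ?_) p <;> simp [toHom]
    simp [this]
  map_add' x y := by
    have : ∀ p : Fin (n + 1), toHom (x + y) p = toHom x p + toHom y p := fun p => by
      refine Fin.cases ?_ (fun i => ?_) p <;> simp [toHom]; ring
    simp only [this]; ring

theorem coordDiff_ofHom (p q : Fin (n + 1)) (c : Fin (n + 1) → ℤ) :
    coordDiff p q (ofHom c) = c p - c q :=
  ofHom_eq_iff.1 (ofHom_toHom (ofHom c)) p q

theorem toHom_eq_of_mem_linSpan {J : Finset (Fin (n + 1))} {p q : Fin (n + 1)}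
    (hp : p ∉ J) (hq : q ∉ J) {x : Fin n → ℝ} (hx : x ∈ linSpan (J.image (fun j => -e j))) :
    toHom x p = toHom x q := by
  have hadd : ∀ (x y : Fin n → ℝ) (p : Fin (n + 1)), toHom (x + y) p = toHom x p + toHom y p := by
    intro x y p
    refine Fin.cases ?_ (fun i => ?_) p <;> simp [toHom]; ring
  have hsmul : ∀ (t : ℝ) (y : Fin n → ℝ) (p : Fin (n + 1)), toHom (t • y) p = t * toHom y p := by
    intro x y p
    refine Fin.cases ?_ (fun i => ?_) p <;> simp [toHom]
  induction hx using Submodule.span_induction with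
  | mem x h =>
    obtain ⟨u, hu, rfl⟩ := h
    obtain ⟨j, hj, rfl⟩ := Finset.mem_image.1 hu
    have hpj : p ≠ j := fun h => hp (h ▸ hj)
    have hqj : q ≠ j := fun h => hq (h ▸ hj)
    have := ofHom_eq_iff.1 (ofHom_toHom (toReal n (-e j))|>.trans
      (by rw [neg_e_eq_ofHom, toReal_ofHom])) p q
    simpa [Pi.single_apply, hpj, hqj, sub_eq_zero] using this
  | zero => have := hsmul 0 0; simp at this; simp [this]
  | add x y _ _ hx hy => simp [hadd, hx, hy]
  | smul t x _ hx => simp [hsmul, hx]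

theorem lattice_hyperplaneCone (J : HyperplaneIndex n) {p q : Fin (n + 1)}
    (hJ : J.1ᶜ = {p, q}) : lattice (hyperplaneCone n J) = (coordDiff p q).ker := by
  have hmem : ∀ j, j ∉ J.1 ↔ j = p ∨ j = q := fun j => by
    rw [← Finset.mem_compl, hJ]; simp
  ext u
  rw [AddMonoidHom.mem_ker, ← ofHom_toHom u, coordDiff_ofHom, sub_eq_zero]
  change toReal n _ ∈ linSpan _ ↔ _
  rw [toReal_ofHom]
  constructor
  · intro h
    have h1 := toHom_eq_of_mem_linSpan ((hmem p).2 (.inl rfl)) ((hmem q).2 (.inr rfl)) h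
    have := ofHom_eq_iff.1 (ofHom_toHom (ofHom (fun j => ((toHom u j : ℤ) : ℝ)))) p q
    rw [h1, sub_self, eq_comm, sub_eq_zero] at this
    exact_mod_cast this
  · intro h
    have : ofHom (fun j => ((toHom u j : ℤ) : ℝ)) =
        ofHom (fun j => ((toHom u j : ℤ) : ℝ) - ((toHom u p : ℤ) : ℝ)) := by
      rw [ofHom_eq_iff]; intro j k; ring
    rw [this]
    refine ofHom_mem_linSpan fun j hj => ?_
    rcases (hmem j).1 hj with rfl | rfl <;> simp [h]

theorem lattice_singleton {r : Fin n → ℤ} (hr : Finset.univ.gcd r = 1) :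
    lattice {r} = AddSubgroup.zmultiples r := by
  ext u
  rw [AddSubgroup.mem_zmultiples_iff]
  change toReal n u ∈ Submodule.span ℝ _ ↔ _
  rw [Finset.coe_singleton, Set.image_singleton, Submodule.mem_span_singleton]
  constructor
  · rintro ⟨t, ht⟩
    obtain ⟨g, hg⟩ := Finset.gcd_eq_sum_mul Finset.univ r
    rw [hr] at hg
    have hu : ∀ i, t * (r i : ℝ) = u i := fun i => congrFun ht i
    -- Primitivity enters through Bézout: pairing t·r = u with the coefficients g shows that t is an
    -- integer.
    have htz : t = ((∑ i, u i * g i : ℤ) : ℝ) := by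
      have h1 : (1 : ℝ) = ∑ i, (r i : ℝ) * (g i : ℝ) := by exact_mod_cast hg
      push_cast
      rw [← mul_one t, h1, Finset.mul_sum]
      simp only [← hu, mul_assoc]
    refine ⟨∑ i, u i * g i, ?_⟩
    ext i
    have := hu i
    rw [htz] at this
    rw [Pi.smul_apply, smul_eq_mul]
    exact_mod_cast this
  · rintro ⟨z, rfl⟩
    exact ⟨z, by ext i; simp [toReal]⟩

/-- The cone's lattice is the kernel of the surjection `coordDiff p q` onto ℤ, so the index can be
computed in ℤ, where r maps to a_p - a_q. -/
theorem latticeIndex_ray {r : Fin n → ℤ} (hr : Finset.univ.gcd r = 1) {a : Fin (n + 1) → ℕ}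
    (ha : r = ofHom (fun j => (a j : ℤ))) (J : HyperplaneIndex n) {p q : Fin (n + 1)}
    (hpq : p ≠ q) (hJ : J.1ᶜ = {p, q}) :
    latticeIndex {r} (hyperplaneCone n J) = ((a p : ℤ) - a q).natAbs := by
  have hrange : (coordDiff p q : (Fin n → ℤ) →+ ℤ).range = ⊤ := by
    rw [AddMonoidHom.range_eq_top]
    intro z
    refine ⟨ofHom (Pi.single p z), ?_⟩
    rw [coordDiff_ofHom]
    simp [hpq.symm]
  have h := AddSubgroup.index_map (AddSubgroup.zmultiples r) (coordDiff p q)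
  rw [hrange, AddSubgroup.index_top, mul_one, AddMonoidHom.map_zmultiples,
    Int.index_zmultiples] at h
  rw [latticeIndex, lattice_singleton hr, lattice_hyperplaneCone J hJ, ← h]
  simp only [ha, coordDiff_ofHom]

/-- Turns the index into a count of levels c, so that the later sum can be taken level by level. -/
theorem card_filter_separated (a : Fin (n + 1) → ℕ) {N : ℕ} (hN : ∀ j, a j ≤ N)
    {K : Finset (Fin (n + 1))} {p q : Fin (n + 1)} (hK : K = {p, q}) :
    ((a p : ℤ) - a q).natAbs =
      ((Finset.range N).filter (fun c => (∃ j ∈ K, a j ≤ c) ∧ ∃ j ∈ K, c < a j)).card := by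
  wlog h : a q ≤ a p generalizing p q
  · rw [← this (p := q) (q := p) (by rw [hK, Finset.pair_comm]) (by omega)]
    omega
  have : (Finset.range N).filter (fun c => (∃ j ∈ K, a j ≤ c) ∧ ∃ j ∈ K, c < a j) =
      Finset.Ico (a q) (a p) := by
    ext c
    have := hN p
    have := hN q
    simp only [hK, Finset.mem_filter, Finset.mem_range, Finset.mem_insert, Finset.mem_singleton,
      exists_eq_or_imp, exists_eq_left, Finset.mem_Ico]
    omega
  rw [this, Nat.card_Ico]
  omega

/-! ### Proper subspaces and generic displacements -/

theorem linSpan_sup_ne_top {S T : Finset (Fin n → ℤ)} (h : S.card + T.card < n) :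
    linSpan S ⊔ linSpan T ≠ ⊤ := by
  classical
  intro htop
  have h1 : linSpan S ⊔ linSpan T =
      Submodule.span ℝ (((S ∪ T).image (toReal n) : Finset (Fin n → ℝ)) : Set (Fin n → ℝ)) := by
    rw [linSpan, linSpan, ← Submodule.span_union, ← Set.image_union]
    simp
  have h2 := finrank_span_finset_le_card (R := ℝ) ((S ∪ T).image (toReal n))
  rw [Set.finrank, ← h1, htop, finrank_top, Module.finrank_fintype_fun_eq_card,
    Fintype.card_fin] at h2
  have h3 := Finset.card_image_le (s := S ∪ T) (f := toReal n)
  have h4 := Finset.card_union_le S T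
  omega

/-- A real vector space is not a finite union of proper subspaces. -/
theorem exists_isGeneric {ι κ : Type} [Finite ι] [Finite κ] (σ : ι → Finset (Fin n → ℤ))
    (τ : κ → Finset (Fin n → ℤ)) : ∃ v, IsGeneric σ τ v := by
  classical
  let I := {x : (Σ i : ι, (σ i).powerset) × (Σ k : κ, (τ k).powerset) //
    linSpan x.1.2.1 ⊔ linSpan x.2.2.1 ≠ ⊤}
  let P : I → Submodule ℝ (Fin n → ℝ) := fun x => linSpan x.1.1.2.1 ⊔ linSpan x.1.2.2.1
  have hne : (⋃ x, (P x : Set (Fin n → ℝ))) ≠ Set.univ := fun h => by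
    obtain ⟨x, hx⟩ := Subspace.exists_eq_top_of_iUnion_eq_univ h
    exact x.2 hx
  obtain ⟨v, hv⟩ := (Set.ne_univ_iff_exists_notMem _).1 hne
  refine ⟨v, fun i k S hS T hT htop hmem => hv (Set.mem_iUnion.2 ⟨⟨⟨⟨i, S, ?_⟩, ⟨k, T, ?_⟩⟩, htop⟩, hmem⟩)⟩
  · exact Finset.mem_powerset.2 hS
  · exact Finset.mem_powerset.2 hT

end TropicalFan

namespace TropicalFan

/-! ### Lower envelopes of affine functions -/

section LowerEnvelope

variable {ι : Type*} {a : ι → ℕ} {w : ι → ℝ}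

/-- For some `t ≥ 0`, all `p ∈ K` attain the minimum of the affine functions `t ↦ a_j t - w_j`. -/
def AttainMin (a : ι → ℕ) (w : ι → ℝ) (K : Finset ι) : Prop :=
  ∃ t : ℝ, 0 ≤ t ∧ ∀ p ∈ K, ∀ j, t * a p - w p ≤ t * a j - w j

/-- The slopes in `K` lie on both sides of `c + 1/2`. -/
def Separated (a : ι → ℕ) (K : Finset ι) (c : ℕ) : Prop :=
  (∃ j ∈ K, a j ≤ c) ∧ ∃ j ∈ K, c < a j

/-- The minimum F over slopes above c starts below the minimum G over the other slopes and ends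
above it; where they cross, a minimiser of each gives the pair. -/
theorem exists_attainMin_separated [Fintype ι] {j₀ : ι} (hj₀ : ∀ j, w j ≤ w j₀) (h0 : ∃ l, a l = 0) {c : ℕ}
    (hc : c < a j₀) : ∃ K : Finset ι, K.card = 2 ∧ AttainMin a w K ∧ Separated a K c := by
  classical
  obtain ⟨l, hl⟩ := h0
  set A := Finset.univ.filter fun j => c < a j with hA
  set B := Finset.univ.filter fun j => a j ≤ c with hB
  have hAne : A.Nonempty := ⟨j₀, by simp [hA, hc]⟩
  have hBne : B.Nonempty := ⟨l, by simp [hB, hl]⟩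
  let f : ι → ℝ → ℝ := fun j t => t * a j - w j
  have hcont : ∀ j, Continuous (f j) := fun j => by fun_prop
  let F : ℝ → ℝ := fun t => A.inf' hAne (fun j => f j t)
  let G : ℝ → ℝ := fun t => B.inf' hBne (fun j => f j t)
  have hF : Continuous F := Continuous.finset_inf'_apply hAne fun j _ => hcont j
  have hG : Continuous G := Continuous.finset_inf'_apply hBne fun j _ => hcont j
  -- By this time every line of slope at least 1 is above the line of slope 0.
  let T : ℝ := 2 * ∑ j, |w j|
  have hw : ∀ j, |w j| ≤ ∑ j, |w j| := fun j =>
    Finset.single_le_sum (f := fun j => |w j|) (fun _ _ => abs_nonneg _) (Finset.mem_univ j)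
  have hT : 0 ≤ T := by
    have := (abs_nonneg _).trans (hw j₀)
    simp only [T]; linarith
  have hstart : F 0 ≤ G 0 := by
    refine Finset.le_inf' _ _ fun j _ => (Finset.inf'_le _ (show j₀ ∈ A by simp [hA, hc])).trans ?_
    simpa [f] using hj₀ j
  have hend : G T ≤ F T := by
    refine Finset.le_inf' _ _ fun j hj => (Finset.inf'_le _ (show l ∈ B by simp [hB, hl])).trans ?_
    have hj1 : (1 : ℝ) ≤ a j := by
      have : c < a j := by simpa [hA] using hj
      exact_mod_cast (by omega : 1 ≤ a j)
    have h1 := (le_abs_self _).trans (hw j)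
    have h2 := (neg_abs_le (w l))
    have h3 := hw l
    have h4 := mul_le_mul_of_nonneg_left hj1 hT
    simp only [f, hl, Nat.cast_zero, mul_zero]
    simp only [T] at h4 ⊢
    linarith
  obtain ⟨t, ht, hFG⟩ := intermediate_value_Icc hT (hF.sub hG).continuousOn
    (show (0 : ℝ) ∈ Set.Icc _ _ from ⟨sub_nonpos.2 hstart, sub_nonneg.2 hend⟩)
  have hFG : F t = G t := sub_eq_zero.1 hFG
  obtain ⟨p, hp, hpF⟩ := Finset.exists_mem_eq_inf' hAne (fun j => f j t)
  obtain ⟨q, hq, hqG⟩ := Finset.exists_mem_eq_inf' hBne (fun j => f j t)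
  have hmin : ∀ j, F t ≤ f j t := by
    intro j
    rcases lt_or_ge c (a j) with h | h
    · exact Finset.inf'_le _ (show j ∈ A by simp [hA, h])
    · rw [hFG]
      exact Finset.inf'_le _ (show j ∈ B by simp [hB, h])
  have hp' : c < a p := by simpa [hA] using hp
  have hq' : a q ≤ c := by simpa [hB] using hq
  refine ⟨{p, q}, Finset.card_pair (by rintro rfl; omega), ⟨t, ht.1, ?_⟩,
    ⟨q, by simp, hq'⟩, ⟨p, by simp, hp'⟩⟩
  intro x hx j
  rcases Finset.mem_insert.1 hx with rfl | hx
  · exact hpF.symm.trans_le (hmin j)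
  · obtain rfl := Finset.mem_singleton.1 hx
    exact hqG.symm.trans_le (hFG.symm.trans_le (hmin j))

/-- The envelope is concave, so its slope passes level c at only one time; at that time `hgen`
forbids a third minimiser. -/
theorem attainMin_separated_unique
    (hgen : ∀ t p q l, p ≠ q → p ≠ l → q ≠ l → t * a p - w p = t * a q - w q →
      t * a p - w p ≠ t * a l - w l) {c : ℕ} {K K' : Finset ι}
    (hK : K.card = 2) (hK' : K'.card = 2) (hm : AttainMin a w K) (hm' : AttainMin a w K')
    (hs : Separated a K c) (hs' : Separated a K' c) : K = K' := by
  classical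
  obtain ⟨t, ht, hm⟩ := hm
  obtain ⟨t', ht', hm'⟩ := hm'
  wlog hle : t ≤ t' generalizing K K' t t'
  · exact (this hK' hK hs' hs t' ht' hm' t ht hm (le_of_not_ge hle)).symm
  rcases hle.lt_or_eq with hlt | rfl
  · obtain ⟨q, hq, hqc⟩ := hs.1
    obtain ⟨p, hp, hpc⟩ := hs'.2
    have h1 := hm q hq p
    have h2 := hm' p hp q
    have h3 : (a q : ℝ) < a p := by exact_mod_cast hqc.trans_lt hpc
    nlinarith
  · by_contra hne
    obtain ⟨p, q, hpq, rfl⟩ := Finset.card_eq_two.1 hK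
    have : ¬ K' ⊆ {p, q} := fun h => hne (Finset.eq_of_subset_of_card_le h (by omega)).symm
    obtain ⟨l, hl, hlK⟩ := Finset.not_subset.1 this
    simp only [Finset.mem_insert, Finset.mem_singleton, not_or] at hlK
    exact hgen t p q l hpq (Ne.symm hlK.1) (Ne.symm hlK.2)
      (le_antisymm (hm p (by simp) q) (hm q (by simp) p))
      (le_antisymm (hm p (by simp) l) (hm' l hl p))

theorem lt_of_attainMin_separated {j₀ : ι} (hj₀ : ∀ j, w j ≤ w j₀)
    (hw : ∀ p q, p ≠ q → w p ≠ w q) {c : ℕ} {K : Finset ι}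
    (hm : AttainMin a w K) (hs : Separated a K c) : c < a j₀ := by
  by_contra! hc
  obtain ⟨t, ht, hm⟩ := hm
  obtain ⟨p, hp, hpc⟩ := hs.2
  have h1 := hm p hp j₀
  have h2 : (a j₀ : ℝ) < a p := by exact_mod_cast hc.trans_lt hpc
  have h3 := hj₀ p
  -- Strictness rules out a tie at t = 0.
  have h4 : w p ≠ w j₀ := hw _ _ (by rintro rfl; omega)
  have h5 := lt_of_le_of_ne h3 h4
  nlinarith

end LowerEnvelope

variable {n : ℕ}

/-! ### One ray against the displaced hyperplane -/

theorem HyperplaneIndex.card_compl (J : HyperplaneIndex n) : J.1ᶜ.card = 2 := by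
  have := J.2
  rw [Finset.card_compl, Fintype.card_fin]
  omega

theorem ray_meets_iff {r : Fin n → ℤ} {a : Fin (n + 1) → ℕ}
    (ha : r = ofHom (fun j => (a j : ℤ))) (v : Fin n → ℝ) (J : HyperplaneIndex n) :
    (∃ x ∈ cone {r}, ∃ y ∈ cone (hyperplaneCone n J), x = y + v) ↔
      AttainMin a (toHom v) J.1ᶜ := by
  have hr : ∀ t : ℝ, t • toReal n r = ofHom (fun j => t * a j - toHom v j) + v := by
    intro t
    nth_rw 2 [← ofHom_toHom v]
    ext i
    simp [ha, toReal, ofHom]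
    ring
  constructor
  · rintro ⟨x, ⟨s, hs, rfl⟩, y, hy, hxy⟩
    obtain ⟨c, hc, hcJ, rfl⟩ := (mem_cone_image_iff _ _).1 hy
    rw [Finset.sum_singleton, hr] at hxy
    refine ⟨s r, hs r (by simp), fun p hp j => ?_⟩
    have := ofHom_eq_iff.1 (add_right_cancel hxy) p j
    rw [hcJ p (Finset.mem_compl.1 hp)] at this
    linarith [hc j]
  · rintro ⟨t, ht, hm⟩
    obtain ⟨p, hp⟩ : J.1ᶜ.Nonempty := Finset.card_pos.1 (by rw [J.card_compl]; norm_num)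
    refine ⟨t • toReal n r, ⟨fun _ => t, fun _ _ => ht, by simp⟩,
      ofHom (fun j => t * a j - toHom v j), (mem_cone_image_iff _ _).2
      -- Subtracting the common minimum leaves the point unchanged and makes the coordinates
      -- nonnegative and zero off J.
      ⟨fun j => (t * a j - toHom v j) - (t * a p - toHom v p), fun j => sub_nonneg.2 (hm p hp j),
      fun j hj => ?_, ?_⟩, hr t⟩
    · have hj := Finset.mem_compl.2 hj
      exact sub_eq_zero.2 (le_antisymm (hm j hj p) (hm p hp j))
    · rw [ofHom_eq_iff]; intro j k; ring

section Generic

variable {κ : Type} {r : κ → Fin n → ℤ} {v : Fin n → ℝ}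

theorem IsGeneric.toHom_ne (hv : IsGeneric (fun i => {r i}) (hyperplaneCone n) v) (i : κ)
    {p q : Fin (n + 1)} (hpq : p ≠ q) : toHom v p ≠ toHom v q := by
  intro h
  have hcard : ({p, q} : Finset (Fin (n + 1)))ᶜ.card + 1 = n := by
    have h1 := Finset.card_le_univ ({p, q} : Finset (Fin (n + 1)))
    rw [Finset.card_compl, Fintype.card_fin]
    rw [Finset.card_pair hpq, Fintype.card_fin] at *
    omega
  -- With the apex as face of the ray, the n - 1 generators of the cone span a proper subspace.
  refine hv i ⟨_, hcard⟩ ∅ (by simp) _ subset_rfl (linSpan_sup_ne_top ?_) ?_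
  · have := Finset.card_image_le (s := ({p, q} : Finset (Fin (n + 1)))ᶜ)
      (f := fun j => -(e j : Fin n → ℤ))
    simp only [hyperplaneCone, Finset.card_empty]
    omega
  · refine Submodule.mem_sup_right ?_
    have : v = ofHom (fun j => toHom v j - toHom v p) := by
      nth_rw 1 [← ofHom_toHom v]
      rw [ofHom_eq_iff]; intro j k; ring
    rw [this]
    refine ofHom_mem_linSpan fun j hj => ?_
    have : j = p ∨ j = q := by
      rw [Finset.notMem_compl] at hj
      simpa using hj
    rcases this with rfl | rfl <;> simp [h]

/-- A triple tie would put v in the span of the ray and n - 2 hyperplane rays, a proper subspace. -/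
theorem IsGeneric.not_triple (hv : IsGeneric (fun i => {r i}) (hyperplaneCone n) v) (i : κ)
    {a : Fin (n + 1) → ℕ} (ha : r i = ofHom (fun j => (a j : ℤ))) (t : ℝ) (p q l : Fin (n + 1))
    (hpq : p ≠ q) (hpl : p ≠ l) (hql : q ≠ l)
    (h : t * a p - toHom v p = t * a q - toHom v q) :
    t * a p - toHom v p ≠ t * a l - toHom v l := by
  intro h'
  have h3 : ({p, q, l} : Finset (Fin (n + 1))).card = 3 := Finset.card_eq_three.2
    ⟨p, q, l, hpq, hpl, hql, rfl⟩
  have h1 := Finset.card_le_univ ({p, q, l} : Finset (Fin (n + 1)))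
  rw [h3, Fintype.card_fin] at h1
  have hcard : ({p, q} : Finset (Fin (n + 1)))ᶜ.card + 1 = n := by
    rw [Finset.card_compl, Fintype.card_fin, Finset.card_pair hpq]
    omega
  refine hv i ⟨_, hcard⟩ {r i} subset_rfl
    (({p, q, l} : Finset (Fin (n + 1)))ᶜ.image (fun j => -e j)) ?_ (linSpan_sup_ne_top ?_) ?_
  · refine Finset.image_subset_image (Finset.compl_subset_compl.2 ?_)
    intro x; simp; tauto
  · have := Finset.card_image_le (s := ({p, q, l} : Finset (Fin (n + 1)))ᶜ)
      (f := fun j => -(e j : Fin n → ℤ))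
    rw [Finset.card_compl, Fintype.card_fin, h3] at this
    rw [Finset.card_singleton]
    omega
  · have hveq : v = t • toReal n (r i) +
        -ofHom (fun j => (t * a j - toHom v j) - (t * a p - toHom v p)) := by
      nth_rw 1 [← ofHom_toHom v]
      ext k
      simp [ha, toReal, ofHom]
      ring
    rw [hveq]
    refine Submodule.add_mem_sup (Submodule.smul_mem _ _ (Submodule.subset_span ?_))
      (Submodule.neg_mem _ (ofHom_mem_linSpan fun j hj => ?_))
    · exact ⟨_, by simp, rfl⟩
    · have : j = p ∨ j = q ∨ j = l := by
        rw [Finset.notMem_compl] at hj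
        simpa using hj
      rcases this with rfl | rfl | rfl
      · simp
      · rw [h, sub_self]
      · rw [h', sub_self]

end Generic

-- Double counting: each level c below a_{j₀} is separated by exactly one minimising pair, and no
-- other level is.
open Classical in
theorem sum_latticeIndex_ray {κ : Type} {r : κ → Fin n → ℤ} {v : Fin n → ℝ}
    (hv : IsGeneric (fun i => {r i}) (hyperplaneCone n) v) (i : κ)
    (hr : Finset.univ.gcd (r i) = 1) {a : Fin (n + 1) → ℕ}
    (ha : r i = ofHom (fun j => (a j : ℤ))) (h0 : ∃ l, a l = 0) {j₀ : Fin (n + 1)}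
    (hj₀ : ∀ j, toHom v j ≤ toHom v j₀) :
    (∑ J : HyperplaneIndex n,
      if ∃ x ∈ cone {r i}, ∃ y ∈ cone (hyperplaneCone n J), x = y + v
        then latticeIndex {r i} (hyperplaneCone n J) else 0) = a j₀ := by
  set N := ∑ j, a j with hN
  have haN : ∀ j, a j ≤ N := fun j =>
    Finset.single_le_sum (f := a) (fun _ _ => Nat.zero_le _) (Finset.mem_univ j)
  have hterm : ∀ J : HyperplaneIndex n,
      (if ∃ x ∈ cone {r i}, ∃ y ∈ cone (hyperplaneCone n J), x = y + v
        then latticeIndex {r i} (hyperplaneCone n J) else 0) =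
      ∑ c ∈ Finset.range N,
        if AttainMin a (toHom v) J.1ᶜ ∧ Separated a J.1ᶜ c then 1 else 0 := by
    intro J
    obtain ⟨p, q, hpq, hJ⟩ := Finset.card_eq_two.1 J.card_compl
    rw [latticeIndex_ray hr ha J hpq hJ, card_filter_separated a haN hJ, ray_meets_iff ha v J,
      Finset.card_filter]
    by_cases h : AttainMin a (toHom v) J.1ᶜ
    · simp only [h, if_true, true_and, Separated]
    · simp [h]
  rw [Finset.sum_congr rfl fun J _ => hterm J, Finset.sum_comm]
  have hcount : ∀ c, (∑ J : HyperplaneIndex n,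
      if AttainMin a (toHom v) J.1ᶜ ∧ Separated a J.1ᶜ c then 1 else 0) =
        if c < a j₀ then 1 else 0 := by
    intro c
    split_ifs with hc
    · obtain ⟨K, hK, hm, hs⟩ := exists_attainMin_separated hj₀ h0 hc
      have hKc : Kᶜ.card + 1 = n := by
        have := Finset.card_le_univ K
        rw [Finset.card_compl]
        rw [Fintype.card_fin] at *
        omega
      rw [Finset.sum_eq_single (⟨Kᶜ, hKc⟩ : HyperplaneIndex n)]
      · simp [hm, hs]
      · intro J _ hJ
        rw [if_neg]
        rintro ⟨hm', hs'⟩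
        refine hJ (Subtype.ext ?_)
        have := attainMin_separated_unique (hv.not_triple i ha) hK
          (HyperplaneIndex.card_compl J) hm hm' hs hs'
        simp [this]
      · simp
    · refine Finset.sum_eq_zero fun J _ => if_neg ?_
      rintro ⟨hm, hs⟩
      exact hc (lt_of_attainMin_separated hj₀ (fun _ _ h => hv.toHom_ne i h) hm hs)
  simp only [hcount]
  rw [← Finset.card_filter]
  have : (Finset.range N).filter (fun c => c < a j₀) = Finset.range (a j₀) := by
    ext c
    have := haN j₀
    simp only [Finset.mem_filter, Finset.mem_range]
    omega
  rw [this, Finset.card_range]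

/-! ### Decompositions and the degree -/

theorem isDecomposition_iff {u : Fin n → ℤ} {a : Fin (n + 1) → ℕ} :
    IsDecomposition u a ↔ u = ofHom (fun j => (a j : ℤ)) ∧ ∃ j, a j = 0 := by
  rw [IsDecomposition, sum_smul_neg_e]

theorem exists_isDecomposition (u : Fin n → ℤ) : ∃ a, IsDecomposition u a := by
  obtain ⟨l, hl⟩ := Finite.exists_min (toHom u)
  refine ⟨fun j => (toHom u j - toHom u l).toNat, isDecomposition_iff.2 ⟨?_, l, by simp⟩⟩
  nth_rw 1 [← ofHom_toHom u]
  rw [ofHom_eq_iff]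
  intro j k
  rw [Int.toNat_of_nonneg (sub_nonneg.2 (hl j)), Int.toNat_of_nonneg (sub_nonneg.2 (hl k))]
  ring

/-- The two coordinate vectors differ by a constant, and both have minimum 0. -/
theorem IsDecomposition.unique {u : Fin n → ℤ} {a b : Fin (n + 1) → ℕ}
    (ha : IsDecomposition u a) (hb : IsDecomposition u b) : a = b := by
  obtain ⟨ha, p, hp⟩ := isDecomposition_iff.1 ha
  obtain ⟨hb, q, hq⟩ := isDecomposition_iff.1 hb
  have h := ofHom_eq_iff.1 (ha.symm.trans hb)
  ext j
  have h1 := h p q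
  have h2 := h j p
  omega

theorem IsDecomposition.smul {u : Fin n → ℤ} {a : Fin (n + 1) → ℕ} (ha : IsDecomposition u a)
    (m : ℕ) : IsDecomposition (m • u) (fun j => m * a j) := by
  obtain ⟨ha, p, hp⟩ := isDecomposition_iff.1 ha
  refine isDecomposition_iff.2 ⟨?_, p, by simp [hp]⟩
  ext i
  simp [ha, ofHom, mul_sub]

theorem Curve.sum_mult_mul_eq (C : Curve n) {a : Fin C.k → Fin (n + 1) → ℕ}
    (ha : ∀ i, IsDecomposition (C.r i) (a i)) (j : Fin (n + 1)) :
    ∑ i, C.m i * a i j = ∑ i, C.m i * a i 0 := by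
  refine Fin.cases rfl (fun s => ?_) j
  have h := congrFun C.balanced s
  have hr : ∀ i, C.r i s = (a i 0 : ℤ) - a i s.succ := fun i =>
    congrFun (isDecomposition_iff.1 (ha i)).1 s
  rw [Finset.sum_apply, Pi.zero_apply] at h
  simp only [nsmul_eq_mul, Pi.mul_apply, Pi.natCast_apply, hr, mul_sub, Finset.sum_sub_distrib,
    sub_eq_zero] at h
  exact_mod_cast h.symm

theorem Curve.hasDegree_sum (C : Curve n) {a : Fin C.k → Fin (n + 1) → ℕ}
    (ha : ∀ i, IsDecomposition (C.r i) (a i)) : C.HasDegree (∑ i, C.m i * a i 0) := by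
  classical
  refine ⟨exists_isGeneric _ _, fun v hv => ?_⟩
  obtain ⟨j₀, hj₀⟩ := Finite.exists_max (toHom v)
  -- The index j₀ depends on v but not on the ray; balancing allows replacing 0 by it.
  rw [← C.sum_mult_mul_eq ha j₀, displacedNumber]
  refine Finset.sum_congr rfl fun i _ => ?_
  obtain ⟨hai, h0⟩ := isDecomposition_iff.1 (ha i)
  rw [← sum_latticeIndex_ray hv i (C.primitive i) hai h0 hj₀, Finset.mul_sum]
  refine Finset.sum_congr rfl fun J _ => ?_
  rw [mul_ite, mul_zero, mul_one]

end TropicalFan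

theorem lemma2p4 {n : ℕ} (C : TropicalFan.Curve n) :
    (∀ i, ∃ a, TropicalFan.IsDecomposition (C.r i) a) ∧
    ∃ d : ℕ, C.HasDegree d ∧
      (∀ a : Fin C.k → Fin (n + 1) → ℕ,
        (∀ i, TropicalFan.IsDecomposition (C.r i) (a i)) →
          ∀ j, ∑ i, C.m i * a i j = d) ∧
      (∀ b : Fin C.k → Fin (n + 1) → ℕ,
        (∀ i, TropicalFan.IsDecomposition (C.m i • C.r i) (b i)) →
          ∀ j, ∑ i, b i j = d) := by
  choose a ha using fun i => TropicalFan.exists_isDecomposition (C.r i)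
  refine ⟨fun i => ⟨a i, ha i⟩, _, C.hasDegree_sum ha, fun a' ha' j => ?_, fun b hb j => ?_⟩
  · obtain rfl : a' = a := funext fun i => (ha' i).unique (ha i)
    exact C.sum_mult_mul_eq ha j
  · rw [← C.sum_mult_mul_eq ha j]
    refine Finset.sum_congr rfl fun i _ => ?_
    exact congrFun ((hb i).unique ((ha i).smul (C.m i))) j
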